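/- Let $d\ge 0$ and let $G$ be a simple graph with vertex set $[d]=\{1,\dots,d\}$. For a permutation $\pi=a_1a_2\cdots a_d$ of $[d]$ let $\ell(k)$ be the length (number of edges) of the longest path $a_{i_1},\dots,a_{i_p}=a_k$ of $G$ with $i_1<\cdots<i_p=k$. An integer $k\in\{0,\dots,d-1\}$ is a *cut* of $\pi$ if $k=0$, or $\ell(k)<\ell(k+1)$, or $\ell(k)=\ell(k+1)$ and $a_k<a_{k+1}$. The *coloring complex* $\Delta_G$ is the simplicial complex whose faces are the chains $F=\{S_1\subsetneq\cdots\subsetneq S_m\}$, $m\ge 0$, of nonempty proper subsets of $[d]$ such that for no permutation $\pi$ does $F$ contain all the sets $\{a_1,\dots,a_k\}$, $k>0$ a cut of $\pi$. (Equivalently, its face ring is the face ring of the order complex of the Boolean algebra on $[d]$ with $\emptyset$ and $[d]$ removed, modulo the ideal generated by the monomials $\prod_{k>0\text{ a cut of }\pi}x_{\{a_1,\dots,a_k\}}$. If $G$ has no edges, then $\Delta_G$ has no faces, not even the empty one.) Let $\chi(\Delta_G)=\sum_{\emptyset\ne F\in\Delta_G}(-1)^{|F|-1}$ be the Euler characteristic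 and $\tilde\chi(\Delta_G)=\sum_{F\in\Delta_G}(-1)^{|F|-1}$, the sum now including the empty face if it is a face, the reduced Euler characteristic. Let $a(G)$ be the number of acyclic orientations of $G$. **Theorem.** Up to the sign $(-1)^{d-3}$ of the reduced Euler characteristic, the Euler characteristic of $\Delta_G$ equals the number of acyclic orientations of $G$. Precisely: 1. $(-1)^{d-3}\,\tilde\chi(\Delta_G)+1=a(G)$. 2. Let $r$ be the largest cardinality of a face of $\Delta_G$ ($r=0$ if there are no faces) and let $(h_0,\dots,h_r)$ be the $h$-vector of $\Delta_G$, that is, $\sum_k h_kt^k=\sum_{F\in\Delta_G}t^{|F|}(1-t)^{r-|F|}$. Then $h_r+1=a(G)$. 3. If $G$ has at least one edge, then $r=d-2$, that is, $\dim\Delta_G=d-3$; moreover $\chi(\Delta_G)=a(G)$ if $d$ is odd, and $\chi(\Delta_G)=2-a(G)$ if $d$ is even. -/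

import Mathlib

namespace ColoringComplex

/-- A finite abstract simplicial complex, given by its set of faces. The empty set counts as a
face of every complex that has a face at all; the complex without any face is allowed. -/
structure FinComplex (α : Type*) where
  faces : Finset (Finset α)
  down_closed : ∀ s ∈ faces, ∀ t : Finset α, t ⊆ s → t ∈ faces

namespace FinComplex

variable {α : Type*}

/-- `K.rank` is one more than the dimension of `K`, the largest cardinality of a face
(and `0` for the complex without faces). -/
def rank (K : FinComplex α) : ℕ := K.faces.sup Finset.card

/-- `K.fVec i` is the number of faces with `i` elements, that is, of dimension `i - 1`. -/
def fVec (K : FinComplex α) (i : ℕ) : ℕ := (K.faces.filter (fun s => s.card = i)).card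

/-- The `h`-vector `(h_0, …, h_r)` with `r = K.rank`, characterized by
`∑ h_k t^k = ∑ f_{i-1} t^i (1 - t)^(r - i)`; it is meant for `k ≤ r`. -/
def hVec (K : FinComplex α) (k : ℕ) : ℤ :=
  ∑ i ∈ Finset.range (k + 1),
    (-1 : ℤ) ^ (k - i) * ((K.rank - i).choose (k - i) : ℤ) * (K.fVec i : ℤ)

/-- The Euler characteristic: the sum of `(-1) ^ dim s` over the nonempty faces `s`, where
`dim s = s.card - 1`. -/
def eulerChar (K : FinComplex α) : ℤ :=
  ∑ s ∈ K.faces.filter (fun s => s.Nonempty), (-1 : ℤ) ^ (s.card - 1)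

/-- The reduced Euler characteristic: the sum of `(-1) ^ dim s` over all faces `s`, the empty
face (of dimension `-1`) included. The exponent `s.card + 1` has the parity of `s.card - 1`. -/
def reducedEulerChar (K : FinComplex α) : ℤ :=
  ∑ s ∈ K.faces, (-1 : ℤ) ^ (s.card + 1)

end FinComplex

/-- For a graph on `[d]` and a permutation `a_0 a_1 … a_(d-1)` (so `a_i = π i`), the length of the
longest path `a_(i_0), a_(i_1), …, a_(i_n) = a_k` in `G` with `i_0 < i_1 < … < i_n = k`; its length
is `n`. The set is bounded and contains `0`, so the supremum is a maximum. -/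
noncomputable def pathLength {d : ℕ} (G : SimpleGraph (Fin d)) (π : Equiv.Perm (Fin d))
    (k : Fin d) : ℕ :=
  sSup {n : ℕ | ∃ p : Fin (n + 1) → Fin d, StrictMono p ∧ p (Fin.last n) = k ∧
    ∀ i : Fin n, G.Adj (π (p i.castSucc)) (π (p i.succ))}

/-- `k` is a cut in `π`: either `k = 0`, or, comparing the letters `π j`, `π k` just before and
just after the `k`-th gap (`k = j + 1`), the path length increases, or it stays the same and the
letters increase. -/
def IsCut {d : ℕ} (G : SimpleGraph (Fin d)) (π : Equiv.Perm (Fin d)) (k : Fin d) : Prop :=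
  (k : ℕ) = 0 ∨ ∃ j : Fin d, (j : ℕ) + 1 = (k : ℕ) ∧
    (pathLength G π j < pathLength G π k ∨
      (pathLength G π j = pathLength G π k ∧ π j < π k))

/-- The set of the first `k` letters of `π`. -/
def initialLetters {d : ℕ} (π : Equiv.Perm (Fin d)) (k : Fin d) : Finset (Fin d) :=
  (Finset.univ.filter (fun i => i < k)).map π.toEmbedding

open Classical in
/-- The cuts `0 = i_1 < i_2 < … < i_m` of `π` divide `π` into the blocks of its `G`-sequence
`B_1, …, B_m`; the short `G`-sequence omits `B_m`. The basic coloring monomial of `π` is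
`x_{S_1} ⋯ x_{S_(m-1)}` with `S_j = B_1 ∪ … ∪ B_j`. This is the set `{S_1, …, S_(m-1)}` of its
indices; `S_j` consists of the letters of `π` before the cut `i_(j+1)`. -/
noncomputable def basicMonomial {d : ℕ} (G : SimpleGraph (Fin d)) (π : Equiv.Perm (Fin d)) :
    Finset (Finset (Fin d)) :=
  (Finset.univ.filter (fun k : Fin d => 0 < (k : ℕ) ∧ IsCut G π k)).image (initialLetters π)

open Classical in
/-- The coloring complex of `G`: the subcomplex of the order complex of the truncated Boolean
algebra (the chains of nonempty proper subsets of `[d]`) whose non-faces are the chains that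
contain the index set of a basic coloring monomial. Equivalently, its face ring is the quotient of
the face ring of that order complex by the ideal generated by the basic coloring monomials. -/
noncomputable def coloringComplex {d : ℕ} (G : SimpleGraph (Fin d)) :
    FinComplex (Finset (Fin d)) where
  faces := Finset.univ.filter (fun F : Finset (Finset (Fin d)) =>
    (∀ S ∈ F, S.Nonempty ∧ S ≠ Finset.univ) ∧
    IsChain (· ⊆ ·) (F : Set (Finset (Fin d))) ∧
    ∀ π : Equiv.Perm (Fin d), ¬ basicMonomial G π ⊆ F)
  down_closed := by
    intro F hF F' hsub
    simp only [Finset.mem_filter, Finset.mem_univ, true_and] at hF ⊢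
    exact ⟨fun S hS => hF.1 S (hsub hS), hF.2.1.mono (Finset.coe_subset.2 hsub),
      fun π h => hF.2.2 π (h.trans hsub)⟩

/-- An acyclic orientation of `G`: every edge of `G` receives exactly one of its two directions,
there are no other arcs, and there is no directed cycle. -/
def IsAcyclicOrientation {V : Type*} (G : SimpleGraph V) (o : Digraph V) : Prop :=
  (∀ u v, G.Adj u v ↔ (o.Adj u v ∨ o.Adj v u)) ∧
  (∀ u v, o.Adj u v → ¬ o.Adj v u) ∧
  ∀ v, ¬ Relation.TransGen o.Adj v v

/-- The number of acyclic orientations of `G`. -/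
noncomputable def numAcyclicOrientations {V : Type*} (G : SimpleGraph V) : ℕ :=
  Nat.card {o : Digraph V // IsAcyclicOrientation G o}

end ColoringComplex

namespace ColoringComplex

open scoped Classical

/-! ### Signed counts of order preserving set compositions -/

section OrderedChains

variable {V : Type*}

/-! A chain `F` of nonempty proper subsets cuts `[d]` into ordered blocks, and `depth F v` is the
index of the block of `v`. The combinatorial core is `mem_faces_coloringComplex`: a chain contains a
basic coloring monomial exactly when no edge lies inside a block. So the faces are all chains minus
the stable ones.

A stable chain orients every edge towards the later block, which is acyclic. The stable chains
inducing a given orientation are its strictly order preserving set compositions, and by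
`sum_orderedChains` their signed count depends only on `d`: for `d > 0` it is `(-1) ^ d`. Stable
chains therefore contribute `(-1) ^ d * a(G)`, all chains (the case of no edges) contribute `(-1) ^
d`, and the reduced Euler characteristic is the difference. The top `h`-entry is this number up to a
sign, fixed by the dimension `d - 3`. -/

/-- The number of members of `F` that do not contain `v`. -/
noncomputable def depth (F : Finset (Finset V)) (v : V) : ℕ := (F.filter (v ∉ ·)).card

/-- As `F` is a chain, the families of members avoiding a given vertex are nested, so comparing
their sizes amounts to comparing the families. -/
theorem depth_lt_iff {F : Finset (Finset V)}
    (hF : IsChain (· ⊆ ·) (F : Set (Finset V))) {u v : V} :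
    depth F u < depth F v ↔ ∃ S ∈ F, u ∈ S ∧ v ∉ S := by
  constructor
  · intro h
    by_contra! hc
    refine absurd h (not_lt.2 (Finset.card_le_card fun S hS => ?_))
    rw [Finset.mem_filter] at hS ⊢
    exact ⟨hS.1, fun hu => hS.2 (hc S hS.1 hu)⟩
  · rintro ⟨S, hS, hu, hv⟩
    refine Finset.card_lt_card (Finset.ssubset_iff_of_subset (fun T hT => ?_) |>.2
      ⟨S, by simp [hS, hv], by simp [hu]⟩)
    rw [Finset.mem_filter] at hT ⊢
    refine ⟨hT.1, fun hvT => ?_⟩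
    rcases hF.total hS hT.1 with h | h
    · exact hT.2 (h hu)
    · exact hv (h hvT)

/-- Chains of nonempty subsets of `W` with top element `W` (unless `W` is empty) whose members are
closed under `r`-predecessors and which separate any two `r`-related elements: the chains of
initial unions of the blocks of the strictly order preserving set compositions of `W`. -/
noncomputable def orderedChains (r : V → V → Prop) (W : Finset V) : Finset (Finset (Finset V)) :=
  W.powerset.powerset.filter fun F =>
    (∀ S ∈ F, S.Nonempty) ∧ (W.Nonempty → W ∈ F) ∧ IsChain (· ⊆ ·) (F : Set (Finset V)) ∧
      ∀ u ∈ W, ∀ v ∈ W, r u v → (∃ S ∈ F, u ∈ S ∧ v ∉ S) ∧ ∀ S ∈ F, v ∈ S → u ∈ S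

theorem mem_orderedChains {r : V → V → Prop} {W : Finset V} {F : Finset (Finset V)} :
    F ∈ orderedChains r W ↔ (∀ S ∈ F, S ⊆ W) ∧ (∀ S ∈ F, S.Nonempty) ∧ (W.Nonempty → W ∈ F) ∧
      IsChain (· ⊆ ·) (F : Set (Finset V)) ∧
      ∀ u ∈ W, ∀ v ∈ W, r u v → (∃ S ∈ F, u ∈ S ∧ v ∉ S) ∧ ∀ S ∈ F, v ∈ S → u ∈ S := by
  simp [orderedChains, Finset.subset_iff (s₁ := F)]

theorem sup_id_eq_of_mem_orderedChains {r : V → V → Prop} {W : Finset V}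
    {F : Finset (Finset V)} (h : F ∈ orderedChains r W) : F.sup id = W := by
  rw [mem_orderedChains] at h
  apply le_antisymm (Finset.sup_le h.1)
  rcases W.eq_empty_or_nonempty with rfl | hW
  · exact Finset.empty_subset _
  · exact Finset.le_sup (f := id) (h.2.2.1 hW)

theorem sup_id_mem_of_isChain {F : Finset (Finset V)}
    (hF : IsChain (· ⊆ ·) (F : Set (Finset V))) (hne : F.Nonempty) : F.sup id ∈ F := by
  obtain ⟨M, hM⟩ := F.exists_maximal hne
  have : F.sup id = M := by
    apply le_antisymm
    · refine Finset.sup_le fun S hS => ?_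
      rcases hF.total hS hM.1 with h | h
      · exact h
      · exact hM.2 hS h
    · exact Finset.le_sup (f := id) hM.1
  exact this ▸ hM.1

theorem insert_mem_orderedChains {r : V → V → Prop} {S W : Finset V} {F : Finset (Finset V)}
    (hSW : S ⊂ W) (hS : ∀ u ∈ W, ∀ v ∈ W, r u v → u ∈ S) (hF : F ∈ orderedChains r S) :
    insert W F ∈ orderedChains r W := by
  rw [mem_orderedChains] at hF ⊢
  obtain ⟨h1, h2, h3, h4, h5⟩ := hF
  have hWne : W.Nonempty :=
    Finset.empty_ssubset.1 ((Finset.empty_subset S).trans_ssubset hSW)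
  refine ⟨?_, ?_, fun _ => Finset.mem_insert_self _ _, ?_, ?_⟩
  · simp only [Finset.mem_insert, forall_eq_or_imp]
    exact ⟨subset_rfl, fun T hT => (h1 T hT).trans hSW.1⟩
  · simp only [Finset.mem_insert, forall_eq_or_imp]
    exact ⟨hWne, h2⟩
  · rw [Finset.coe_insert]
    exact h4.insert fun T hT _ => Or.inr ((h1 T hT).trans hSW.1)
  · intro u hu v hv huv
    have huS := hS u hu v hv huv
    simp only [Finset.mem_insert, exists_eq_or_imp, forall_eq_or_imp]
    by_cases hvS : v ∈ S
    · have := h5 u huS v hvS huv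
      exact ⟨Or.inr this.1, fun _ => hu, this.2⟩
    · exact ⟨Or.inr ⟨S, h3 ⟨u, huS⟩, huS, hvS⟩, fun _ => hu,
        fun T hT hvT => absurd (h1 T hT hvT) hvS⟩

theorem sup_erase_ssubset {r : V → V → Prop} {W : Finset V} (hW : W.Nonempty)
    {F : Finset (Finset V)} (hF : F ∈ orderedChains r W) : (F.erase W).sup id ⊂ W := by
  rw [mem_orderedChains] at hF
  obtain ⟨h1, -, -, h4, -⟩ := hF
  rcases (F.erase W).eq_empty_or_nonempty with h | h
  · rw [h]
    exact Finset.empty_ssubset.2 hW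
  · have := sup_id_mem_of_isChain
      (h4.mono (Finset.coe_subset.2 (Finset.erase_subset W F))) h
    rw [Finset.mem_erase] at this
    exact (h1 _ this.2).ssubset_of_ne this.1

theorem mem_sup_erase_of_rel {r : V → V → Prop} {W : Finset V}
    {F : Finset (Finset V)} (hF : F ∈ orderedChains r W) {u v : V} (hu : u ∈ W) (hv : v ∈ W)
    (huv : r u v) : u ∈ (F.erase W).sup id := by
  rw [mem_orderedChains] at hF
  obtain ⟨S, hS, huS, hvS⟩ := (hF.2.2.2.2 u hu v hv huv).1
  have : S ∈ F.erase W := Finset.mem_erase.2 ⟨by rintro rfl; exact hvS hv, hS⟩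
  exact Finset.le_sup (f := id) this huS

theorem erase_mem_orderedChains {r : V → V → Prop} {W : Finset V} (hW : W.Nonempty)
    {F : Finset (Finset V)} (hF : F ∈ orderedChains r W) :
    F.erase W ∈ orderedChains r ((F.erase W).sup id) := by
  have hss := sup_erase_ssubset hW hF
  rw [mem_orderedChains] at hF ⊢
  obtain ⟨h1, h2, h3, h4, h5⟩ := hF
  have h4' := h4.mono (Finset.coe_subset.2 (Finset.erase_subset W F))
  refine ⟨fun S hS => Finset.le_sup (f := id) hS,
    fun S hS => h2 S (Finset.mem_of_mem_erase hS), fun hne => ?_, h4', ?_⟩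
  · apply sup_id_mem_of_isChain h4'
    by_contra h
    rw [Finset.not_nonempty_iff_eq_empty] at h
    simp [h] at hne
  · intro u hu v hv huv
    obtain ⟨⟨S, hS, huS, hvS⟩, hcl⟩ := h5 u (hss.1 hu) v (hss.1 hv) huv
    refine ⟨⟨S, Finset.mem_erase.2 ⟨?_, hS⟩, huS, hvS⟩,
      fun T hT => hcl T (Finset.mem_of_mem_erase hT)⟩
    rintro rfl
    exact hvS (hss.1 hv)

/-- Removing the top `W` deletes the last block `W \ S` and flips the sign. The condition on `S`
says that the last block consists of elements without `r`-successor in `W`. -/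
theorem sum_orderedChains_step (r : V → V → Prop) {W : Finset V} (hW : W.Nonempty) :
    ∑ F ∈ orderedChains r W, (-1 : ℤ) ^ F.card =
      ∑ S ∈ W.ssubsets.filter (fun S => ∀ u ∈ W, ∀ v ∈ W, r u v → u ∈ S),
        -∑ F ∈ orderedChains r S, (-1 : ℤ) ^ F.card := by
  simp only [← Finset.sum_neg_distrib]
  rw [Finset.sum_sigma']
  refine Finset.sum_bij' (fun F _ => ⟨(F.erase W).sup id, F.erase W⟩)
    (fun p _ => insert W p.2) ?_ ?_ ?_ ?_ ?_
  · intro F hF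
    simp only [Finset.mem_sigma, Finset.mem_filter, Finset.mem_ssubsets]
    exact ⟨⟨sup_erase_ssubset hW hF, fun u hu v hv => mem_sup_erase_of_rel hF hu hv⟩,
      erase_mem_orderedChains hW hF⟩
  · rintro ⟨S, F⟩ h
    simp only [Finset.mem_sigma, Finset.mem_filter, Finset.mem_ssubsets] at h
    exact insert_mem_orderedChains h.1.1 h.1.2 h.2
  · intro F hF
    exact Finset.insert_erase ((mem_orderedChains.1 hF).2.2.1 hW)
  · rintro ⟨S, F⟩ h
    simp only [Finset.mem_sigma, Finset.mem_filter, Finset.mem_ssubsets] at h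
    have hWF : W ∉ F := fun hc => h.1.1.2 ((mem_orderedChains.1 h.2).1 W hc)
    simp only [Finset.erase_insert hWF, sup_id_eq_of_mem_orderedChains h.2]
  · intro F hF
    have := Finset.card_erase_add_one ((mem_orderedChains.1 hF).2.2.1 hW)
    rw [← this, pow_succ]
    ring

/-- The complements `W \ S` are the nonempty sets of maximal elements. The alternating sum over all
subsets of a nonempty set vanishes, so the nonempty ones contribute `-1`. -/
theorem sum_ssubsets_sdiff_maximal (r : V → V → Prop) {W : Finset V}
    (hM : (W.filter fun u => ∀ v ∈ W, ¬ r u v).Nonempty) :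
    ∑ S ∈ W.ssubsets.filter (fun S => ∀ u ∈ W, ∀ v ∈ W, r u v → u ∈ S), -(-1 : ℤ) ^ S.card =
      (-1 : ℤ) ^ W.card := by
  set M := W.filter fun u => ∀ v ∈ W, ¬ r u v
  have key : ∑ S ∈ W.ssubsets.filter (fun S => ∀ u ∈ W, ∀ v ∈ W, r u v → u ∈ S),
      -(-1 : ℤ) ^ S.card = ∑ A ∈ M.powerset.erase ∅, -((-1 : ℤ) ^ W.card * (-1) ^ A.card) := by
    refine Finset.sum_nbij' (W \ ·) (W \ ·) ?_ ?_ ?_ ?_ ?_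
    · intro S hS
      simp only [Finset.mem_filter, Finset.mem_ssubsets] at hS
      rw [Finset.mem_erase, Finset.mem_powerset]
      refine ⟨fun h => hS.1.2 (Finset.sdiff_eq_empty_iff_subset.1 h), fun u hu => ?_⟩
      rw [Finset.mem_sdiff] at hu
      exact Finset.mem_filter.2 ⟨hu.1, fun v hv huv => hu.2 (hS.2 u hu.1 v hv huv)⟩
    · intro A hA
      rw [Finset.mem_erase, Finset.mem_powerset] at hA
      have hAW : A ⊆ W := hA.2.trans (Finset.filter_subset _ _)
      simp only [Finset.mem_filter, Finset.mem_ssubsets]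
      refine ⟨Finset.sdiff_ssubset hAW (Finset.nonempty_iff_ne_empty.2 hA.1),
        fun u hu v hv huv => Finset.mem_sdiff.2 ⟨hu, fun huA => ?_⟩⟩
      exact (Finset.mem_filter.1 (hA.2 huA)).2 v hv huv
    · intro S hS
      simp only [Finset.mem_filter, Finset.mem_ssubsets] at hS
      exact Finset.sdiff_sdiff_eq_self hS.1.1
    · intro A hA
      rw [Finset.mem_erase, Finset.mem_powerset] at hA
      exact Finset.sdiff_sdiff_eq_self (hA.2.trans (Finset.filter_subset _ _))
    · intro S hS
      simp only [Finset.mem_filter, Finset.mem_ssubsets] at hS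
      have h := Finset.card_sdiff_add_card_eq_card hS.1.1
      rw [← h, pow_add, mul_right_comm, ← pow_add, ← two_mul, pow_mul]
      simp
  rw [key, Finset.sum_neg_distrib, ← Finset.mul_sum]
  have h0 := Finset.sum_powerset_neg_one_pow_card_of_nonempty hM
  rw [← Finset.add_sum_erase _ _ (Finset.empty_mem_powerset M)] at h0
  simp only [Finset.card_empty, pow_zero] at h0
  rw [eq_neg_of_add_eq_zero_right h0]
  ring

/-- The signed count of the strictly order preserving set compositions of a finite poset. -/
theorem sum_orderedChains {r : V → V → Prop} (hr : WellFounded fun u v => r v u)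
    (W : Finset V) :
    ∑ F ∈ orderedChains r W, (-1 : ℤ) ^ F.card = (-1 : ℤ) ^ W.card := by
  induction W using Finset.strongInduction with
  | H W ih =>
    rcases W.eq_empty_or_nonempty with rfl | hW
    · have : orderedChains r ∅ = {∅} := by
        ext F
        rw [mem_orderedChains, Finset.mem_singleton]
        constructor
        · rintro ⟨h1, h2, -⟩
          refine Finset.eq_empty_of_forall_notMem fun S hS => ?_
          exact (h2 S hS).ne_empty (Finset.subset_empty.1 (h1 S hS))
        · rintro rfl
          simp
      simp [this]
    -- A minimum for the reversed relation is a maximal element of `W`; transitivity of `r` is not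
    -- required.
    · obtain ⟨m, hmW, hm⟩ := hr.has_min (W : Set V) hW
      rw [sum_orderedChains_step r hW, ← sum_ssubsets_sdiff_maximal r (W := W)
        ⟨m, Finset.mem_filter.2 ⟨hmW, fun v hv => hm v hv⟩⟩]
      refine Finset.sum_congr rfl fun S hS => ?_
      rw [ih S (Finset.mem_ssubsets.1 (Finset.mem_filter.1 hS).1)]

end OrderedChains

/-! ### Stable chains and acyclic orientations -/

section Orientations

variable {d : ℕ} (G : SimpleGraph (Fin d))

/-- The chains of nonempty proper subsets that separate any two adjacent vertices. -/
noncomputable def stableChains : Finset (Finset (Finset (Fin d))) :=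
  Finset.univ.filter fun F => (∀ S ∈ F, S.Nonempty ∧ S ≠ Finset.univ) ∧
    IsChain (· ⊆ ·) (F : Set (Finset (Fin d))) ∧ ∀ u v, G.Adj u v → depth F u ≠ depth F v

/-- The orientation of `G` by increasing depth. -/
def depthOrientation (F : Finset (Finset (Fin d))) : Digraph (Fin d) where
  Adj u v := G.Adj u v ∧ depth F u < depth F v

variable {G}

theorem isAcyclicOrientation_depthOrientation {F : Finset (Finset (Fin d))}
    (hF : F ∈ stableChains G) : IsAcyclicOrientation G (depthOrientation G F) := by
  simp only [stableChains, Finset.mem_filter, Finset.mem_univ, true_and] at hF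
  refine ⟨fun u v => ⟨fun h => ?_, ?_⟩, fun u v h h' => lt_asymm h.2 h'.2, fun v hv => ?_⟩
  · rcases lt_or_gt_of_ne (hF.2.2 u v h) with h' | h'
    · exact Or.inl ⟨h, h'⟩
    · exact Or.inr ⟨h.symm, h'⟩
  · rintro (h | h)
    · exact h.1
    · exact h.1.symm
  · have : ∀ w, Relation.TransGen (depthOrientation G F).Adj v w → depth F v < depth F w := by
      intro w hw
      induction hw with
      | single h => exact h.2
      | tail _ h ih => exact ih.trans h.2
    exact lt_irrefl _ (this v hv)

/-- The transitive closure of an acyclic relation is a strict order, hence well-founded on a finite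
type. -/
theorem wellFounded_of_acyclic {V : Type*} [Finite V] {r : V → V → Prop}
    (h : ∀ v, ¬ Relation.TransGen r v v) : WellFounded fun u v => r v u := by
  have : IsTrans V fun u v => Relation.TransGen r v u := ⟨fun _ _ _ hab hbc => hbc.trans hab⟩
  have : Std.Irrefl fun u v : V => Relation.TransGen r v u := ⟨h⟩
  exact Subrelation.wf (fun h => Relation.TransGen.single h)
    (Finite.wellFounded_of_trans_of_irrefl fun u v => Relation.TransGen r v u)

theorem insert_univ_mem_orderedChains (hd : 0 < d) {F : Finset (Finset (Fin d))}
    (hF : F ∈ stableChains G) :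
    insert Finset.univ F ∈ orderedChains (depthOrientation G F).Adj Finset.univ := by
  have : Nonempty (Fin d) := ⟨⟨0, hd⟩⟩
  simp only [stableChains, Finset.mem_filter, Finset.mem_univ, true_and] at hF
  obtain ⟨h1, h2, -⟩ := hF
  rw [mem_orderedChains]
  refine ⟨fun S _ => Finset.subset_univ S, ?_, fun _ => Finset.mem_insert_self _ _, ?_, ?_⟩
  · simp only [Finset.mem_insert, forall_eq_or_imp]
    exact ⟨Finset.univ_nonempty, fun S hS => (h1 S hS).1⟩
  · rw [Finset.coe_insert]
    exact h2.insert fun T _ _ => Or.inr (Finset.subset_univ T)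
  · intro u _ v _ huv
    obtain ⟨S, hS, huS, hvS⟩ := (depth_lt_iff h2).1 huv.2
    refine ⟨⟨S, Finset.mem_insert_of_mem hS, huS, hvS⟩, ?_⟩
    simp only [Finset.mem_insert, forall_eq_or_imp, Finset.mem_univ, implies_true, true_and]
    intro T hT hvT
    by_contra huT
    exact lt_asymm huv.2 ((depth_lt_iff h2).2 ⟨T, hT, hvT, huT⟩)

/-- Separation along the arcs of `o` makes depth increase along them, so depth recovers `o`. This
inverts the passage from `F` to `insert Finset.univ F`. -/
theorem erase_univ_mem_stableChains {o : Digraph (Fin d)} (ho : IsAcyclicOrientation G o)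
    {F : Finset (Finset (Fin d))} (hF : F ∈ orderedChains o.Adj Finset.univ) :
    F.erase Finset.univ ∈ stableChains G ∧ depthOrientation G (F.erase Finset.univ) = o := by
  rw [mem_orderedChains] at hF
  obtain ⟨-, h2, -, h4, h5⟩ := hF
  have h4' := h4.mono (Finset.coe_subset.2 (Finset.erase_subset Finset.univ F))
  have key : ∀ u v, o.Adj u v →
      depth (F.erase Finset.univ) u < depth (F.erase Finset.univ) v := by
    intro u v huv
    obtain ⟨S, hS, huS, hvS⟩ := (h5 u (Finset.mem_univ u) v (Finset.mem_univ v) huv).1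
    refine (depth_lt_iff h4').2 ⟨S, Finset.mem_erase.2 ⟨?_, hS⟩, huS, hvS⟩
    rintro rfl
    exact hvS (Finset.mem_univ v)
  constructor
  · simp only [stableChains, Finset.mem_filter, Finset.mem_univ, true_and]
    refine ⟨fun S hS => ?_, h4', fun u v huv => ?_⟩
    · rw [Finset.mem_erase] at hS
      exact ⟨h2 S hS.2, hS.1⟩
    · rcases (ho.1 u v).1 huv with h | h
      · exact (key u v h).ne
      · exact (key v u h).ne'
  · ext u v
    constructor
    · rintro ⟨huv, hlt⟩
      rcases (ho.1 u v).1 huv with h | h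
      · exact h
      · exact absurd (key v u h) hlt.asymm
    · intro h
      exact ⟨(ho.1 u v).2 (Or.inl h), key u v h⟩

/-- The exponent `F.card + 1` is the number of blocks, since the full set is adjoined. For `d = 0`
the full set is empty, cannot be adjoined, and the sign would be wrong. -/
theorem sum_stableChains_fiber (hd : 0 < d) {o : Digraph (Fin d)}
    (ho : IsAcyclicOrientation G o) :
    ∑ F ∈ (stableChains G).filter (fun F => depthOrientation G F = o),
      (-1 : ℤ) ^ (F.card + 1) = (-1) ^ d := by
  have h := sum_orderedChains (wellFounded_of_acyclic ho.2.2) (Finset.univ : Finset (Fin d))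
  rw [Finset.card_univ, Fintype.card_fin] at h
  have hne : (Finset.univ : Finset (Fin d)).Nonempty := ⟨⟨0, hd⟩, Finset.mem_univ _⟩
  have hnot : ∀ F ∈ stableChains G, Finset.univ ∉ F := by
    intro F hF hc
    simp only [stableChains, Finset.mem_filter, Finset.mem_univ, true_and] at hF
    exact (hF.1 _ hc).2 rfl
  rw [← h]
  refine Finset.sum_nbij' (insert Finset.univ) (Finset.erase · Finset.univ) ?_ ?_ ?_ ?_ ?_
  · intro F hF
    rw [Finset.mem_filter] at hF
    exact hF.2 ▸ insert_univ_mem_orderedChains hd hF.1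
  · intro F hF
    exact Finset.mem_filter.2 (erase_univ_mem_stableChains ho hF)
  · intro F hF
    exact Finset.erase_insert (hnot F (Finset.mem_filter.1 hF).1)
  · intro F hF
    exact Finset.insert_erase ((mem_orderedChains.1 hF).2.2.1 hne)
  · intro F hF
    rw [Finset.card_insert_of_notMem (hnot F (Finset.mem_filter.1 hF).1)]

variable (G)

theorem sum_stableChains (hd : 0 < d) :
    ∑ F ∈ stableChains G, (-1 : ℤ) ^ (F.card + 1) =
      (-1) ^ d * (numAcyclicOrientations G : ℤ) := by
  rw [← Finset.sum_fiberwise_of_maps_to (s := stableChains G)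
    (t := Finset.univ.filter (IsAcyclicOrientation G)) (g := depthOrientation G)
    (fun F hF => by simpa using isAcyclicOrientation_depthOrientation hF),
    Finset.sum_congr rfl fun o ho => sum_stableChains_fiber hd (Finset.mem_filter.1 ho).2,
    Finset.sum_const, numAcyclicOrientations, Nat.card_eq_fintype_card, Fintype.card_subtype,
    nsmul_eq_mul, mul_comm]

theorem numAcyclicOrientations_bot (V : Type*) :
    numAcyclicOrientations (⊥ : SimpleGraph V) = 1 := by
  rw [numAcyclicOrientations, Nat.card_eq_one_iff_unique]
  refine ⟨⟨fun ⟨o, ho⟩ ⟨o', ho'⟩ => Subtype.ext (Digraph.ext ?_)⟩,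
    ⟨⟨⟨fun _ _ => False⟩, by simp, by simp, fun v hv => ?_⟩⟩⟩
  · ext u v
    have h := (ho.1 u v).not.1 (by simp)
    have h' := (ho'.1 u v).not.1 (by simp)
    tauto
  · obtain ⟨_, h, _⟩ := Relation.TransGen.head'_iff.1 hv
    exact h

end Orientations

/-! ### Cuts and faces of the coloring complex -/

section Paths

variable {d : ℕ} (G : SimpleGraph (Fin d))

/-- The length of the longest path of `G` ending at `v` along which `b` increases. -/
noncomputable def increasingPathLength (b : Fin d → ℕ) (v : Fin d) : ℕ :=
  sSup {n : ℕ | ∃ q : Fin (n + 1) → Fin d, q (Fin.last n) = v ∧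
    ∀ i : Fin n, G.Adj (q i.castSucc) (q i.succ) ∧ b (q i.castSucc) < b (q i.succ)}

variable {G}

/-- Path lengths depend only on how `π` orders the ends of each edge, so any `b` ordering them alike
can replace positions. -/
theorem pathLength_eq_increasingPathLength {b : Fin d → ℕ} {π : Equiv.Perm (Fin d)}
    (h : ∀ i j, G.Adj (π i) (π j) → (i < j ↔ b (π i) < b (π j))) (k : Fin d) :
    pathLength G π k = increasingPathLength G b (π k) := by
  unfold pathLength increasingPathLength
  congr 1
  ext n
  constructor
  · rintro ⟨p, hp, hk, hadj⟩
    exact ⟨fun i => π (p i), congrArg π hk, fun i =>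
      ⟨hadj i, (h _ _ (hadj i)).1 (hp (Fin.castSucc_lt_succ))⟩⟩
  · rintro ⟨q, hk, hadj⟩
    refine ⟨fun i => π.symm (q i), Fin.strictMono_iff_lt_succ.2 fun i => ?_, by simp [hk],
      fun i => by simpa using (hadj i).1⟩
    exact (h _ _ (by simpa using (hadj i).1)).2 (by simpa using (hadj i).2)

theorem bddAbove_pathLength (π : Equiv.Perm (Fin d)) (k : Fin d) :
    BddAbove {n : ℕ | ∃ p : Fin (n + 1) → Fin d, StrictMono p ∧ p (Fin.last n) = k ∧
      ∀ i : Fin n, G.Adj (π (p i.castSucc)) (π (p i.succ))} := by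
  refine ⟨d, ?_⟩
  rintro n ⟨p, hp, -⟩
  have := Fintype.card_le_of_injective p hp.injective
  simp only [Fintype.card_fin] at this
  omega

theorem pathLength_lt_of_adj {π : Equiv.Perm (Fin d)} {i j : Fin d} (hij : i < j)
    (h : G.Adj (π i) (π j)) : pathLength G π i < pathLength G π j := by
  obtain ⟨n, hn, p, hp, hlast, hadj⟩ : ∃ n, n = pathLength G π i ∧ ∃ p : Fin (n + 1) → Fin d,
      StrictMono p ∧ p (Fin.last n) = i ∧ ∀ a : Fin n, G.Adj (π (p a.castSucc)) (π (p a.succ)) :=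
    ⟨_, rfl, Nat.sSup_mem (s := {n : ℕ | ∃ p : Fin (n + 1) → Fin d, StrictMono p ∧
      p (Fin.last n) = i ∧ ∀ a : Fin n, G.Adj (π (p a.castSucc)) (π (p a.succ))})
      ⟨0, fun _ => i, fun a b hab => absurd (Fin.lt_def.1 hab) (by omega), rfl,
        fun a => a.elim0⟩
      (bddAbove_pathLength π i)⟩
  rw [← hn]
  refine Nat.lt_of_succ_le (le_csSup (bddAbove_pathLength π j) ?_)
  refine ⟨Fin.snoc (α := fun _ => Fin d) p j, Fin.strictMono_iff_lt_succ.2 fun a => ?_,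
    Fin.snoc_last _ _, fun a => ?_⟩
  · induction a using Fin.lastCases with
    | last =>
      rw [Fin.snoc_castSucc, Fin.succ_last, Fin.snoc_last]
      exact hlast.trans_lt hij
    | cast a =>
      rw [← Fin.castSucc_succ, Fin.snoc_castSucc, Fin.snoc_castSucc]
      exact hp Fin.castSucc_lt_succ
  · induction a using Fin.lastCases with
    | last =>
      rw [Fin.snoc_castSucc, Fin.succ_last, Fin.snoc_last]
      exact hlast ▸ h
    | cast a =>
      rw [← Fin.castSucc_succ, Fin.snoc_castSucc, Fin.snoc_castSucc]
      exact hadj a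

/-- At a gap that is not a cut the path length cannot rise. -/
theorem exists_isCut_of_pathLength_lt {π : Equiv.Perm (Fin d)} {i j : Fin d} (hij : i < j)
    (h : pathLength G π i < pathLength G π j) : ∃ k, i < k ∧ k ≤ j ∧ IsCut G π k := by
  by_contra! hc
  have key : ∀ n (hn : n < d), (i : ℕ) ≤ n → n ≤ j →
      pathLength G π ⟨n, hn⟩ ≤ pathLength G π i := by
    intro n hn hin
    induction n, hin using Nat.le_induction with
    | base => intro _; exact le_rfl
    | succ n hin ih =>
      intro hnj
      have hcut := hc ⟨n + 1, hn⟩ (Fin.lt_def.2 (Nat.lt_succ_of_le hin)) (Fin.le_def.2 hnj)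
      simp only [IsCut, not_or, not_exists, not_and] at hcut
      have := (hcut.2 ⟨n, by omega⟩ rfl).1
      exact (not_lt.1 this).trans (ih (by omega) (by omega))
  exact absurd (key j j.2 hij.le le_rfl) (not_le.2 h)

theorem mem_initialLetters {π : Equiv.Perm (Fin d)} {i k : Fin d} :
    π i ∈ initialLetters π k ↔ i < k := by
  simp [initialLetters]

/-- Path length rises strictly along an edge, so a cut lies between its ends, and the initial set at
that cut separates them. -/
theorem depth_ne_of_basicMonomial_subset {π : Equiv.Perm (Fin d)} {F : Finset (Finset (Fin d))}
    (hF : IsChain (· ⊆ ·) (F : Set (Finset (Fin d)))) (h : basicMonomial G π ⊆ F)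
    {u v : Fin d} (huv : G.Adj u v) : depth F u ≠ depth F v := by
  have key : ∀ i j, i < j → G.Adj (π i) (π j) → depth F (π i) < depth F (π j) := by
    intro i j hij hadj
    obtain ⟨k, hik, hkj, hcut⟩ := exists_isCut_of_pathLength_lt hij (pathLength_lt_of_adj hij hadj)
    refine (depth_lt_iff hF).2 ⟨initialLetters π k, h ?_, mem_initialLetters.2 hik, ?_⟩
    · refine Finset.mem_image_of_mem _ (Finset.mem_filter.2 ⟨Finset.mem_univ _, ?_, hcut⟩)
      exact (Nat.zero_le _).trans_lt (Fin.lt_def.1 hik)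
    · rw [mem_initialLetters]
      exact not_lt.2 hkj
  obtain ⟨i, rfl⟩ := π.surjective u
  obtain ⟨j, rfl⟩ := π.surjective v
  rcases lt_trichotomy i j with hij | rfl | hij
  · exact (key i j hij huv).ne
  · exact absurd huv (G.loopless.irrefl _)
  · exact (key j i hij huv.symm).ne'

theorem exists_perm_strictMono {K : Type*} [LinearOrder K] (f : Fin d → K)
    (hf : Function.Injective f) : ∃ π : Equiv.Perm (Fin d), StrictMono fun i => f (π i) :=
  ⟨Tuple.sort f, (Tuple.monotone_sort f).strictMono_of_injective
    (hf.comp (Tuple.sort f).injective)⟩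

/-- List the blocks in order, and each block so that it contains no cut. Cuts then occur only
between blocks, where the initial set belongs to `F`. -/
theorem exists_basicMonomial_subset {F : Finset (Finset (Fin d))}
    (hF : IsChain (· ⊆ ·) (F : Set (Finset (Fin d))))
    (h : ∀ u v, G.Adj u v → depth F u ≠ depth F v) :
    ∃ π : Equiv.Perm (Fin d), basicMonomial G π ⊆ F := by
  -- The sorting key needs path lengths before `π` exists; `L` computes them from `F` alone, and
  -- `hpath` confirms them afterwards.
  set L := increasingPathLength G (depth F)
  -- Within a block, path length decreases weakly and, among equal lengths, labels decrease: the
  -- negation of a cut.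
  obtain ⟨π, hπ⟩ := exists_perm_strictMono
    (fun v : Fin d => toLex (depth F v, toLex (OrderDual.toDual (L v), OrderDual.toDual v)))
    (fun u v huv => by simpa using (congrArg (fun x => (ofLex (ofLex x).2).2) huv))
  have hmono : ∀ i j, i ≤ j → depth F (π i) ≤ depth F (π j) := by
    intro i j hij
    have := hπ.monotone hij
    rw [Prod.Lex.toLex_le_toLex] at this
    rcases this with h | h
    · exact h.le
    · exact h.1.le
  have hpath : ∀ k, pathLength G π k = L (π k) := by
    refine fun k => pathLength_eq_increasingPathLength
      (fun i j hadj => ⟨fun hij => ?_, fun hlt => ?_⟩) k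
    · exact (hmono i j hij.le).lt_of_ne (h _ _ hadj)
    · by_contra hij
      exact absurd (hmono j i (not_lt.1 hij)) (not_le.2 hlt)
  refine ⟨π, fun S hS => ?_⟩
  obtain ⟨k, hk, rfl⟩ := Finset.mem_image.1 hS
  obtain ⟨hk0, hcut⟩ := (Finset.mem_filter.1 hk).2
  obtain hk0' | ⟨j, hjk, hcut⟩ := hcut
  · omega
  have hjk' : j < k := Fin.lt_def.2 (by omega)
  have hlt : depth F (π j) < depth F (π k) := by
    have := hπ hjk'
    simp only [Prod.Lex.toLex_lt_toLex, OrderDual.toDual_lt_toDual, ← hpath] at this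
    rcases this with h | ⟨-, h | h⟩
    · exact h
    · rcases hcut with h' | h'
      · exact absurd h h'.asymm
      · exact absurd h'.1 h.ne'
    · rcases hcut with h' | h'
      · exact absurd (OrderDual.toDual_inj.1 h.1) h'.ne
      · exact absurd h.2 h'.2.asymm
  obtain ⟨S, hSF, hjS, hkS⟩ := (depth_lt_iff hF).1 hlt
  -- Depth is monotone along `π`, so `S` is an initial set; it contains the letter before the cut
  -- but not the one after.
  have : initialLetters π k = S := by
    ext v
    obtain ⟨i, rfl⟩ := π.surjective v
    rw [mem_initialLetters]
    constructor
    · intro hik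
      by_contra hiS
      have hij : i ≤ j := Fin.le_def.2 (by have := Fin.lt_def.1 hik; omega)
      exact absurd ((depth_lt_iff hF).2 ⟨S, hSF, hjS, hiS⟩) (not_lt.2 (hmono i j hij))
    · intro hiS
      by_contra hik
      exact absurd ((depth_lt_iff hF).2 ⟨S, hSF, hiS, hkS⟩)
        (not_lt.2 (hmono k i (not_lt.1 hik)))
  exact this ▸ hSF

/-- The faces of the coloring complex are the chains that fail to separate some edge. -/
theorem mem_faces_coloringComplex {F : Finset (Finset (Fin d))} :
    F ∈ (coloringComplex G).faces ↔ (∀ S ∈ F, S.Nonempty ∧ S ≠ Finset.univ) ∧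
      IsChain (· ⊆ ·) (F : Set (Finset (Fin d))) ∧ ∃ u v, G.Adj u v ∧ depth F u = depth F v := by
  simp only [coloringComplex, Finset.mem_filter, Finset.mem_univ, true_and]
  refine and_congr_right fun _ => and_congr_right fun hF => ⟨fun h => ?_, ?_⟩
  · by_contra! hc
    obtain ⟨π, hπ⟩ := exists_basicMonomial_subset hF hc
    exact h π hπ
  · rintro ⟨u, v, huv, he⟩ π hπ
    exact depth_ne_of_basicMonomial_subset hF hπ huv he

end Paths

/-! ### Euler characteristic, `h`-vector and dimension -/

section EulerCharacteristic

variable {d : ℕ} (G : SimpleGraph (Fin d))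

theorem faces_coloringComplex_bot :
    (coloringComplex (⊥ : SimpleGraph (Fin d))).faces = ∅ := by
  refine Finset.eq_empty_of_forall_notMem fun F hF => ?_
  obtain ⟨-, -, u, v, h, -⟩ := mem_faces_coloringComplex.1 hF
  simp at h

theorem faces_coloringComplex_eq_sdiff :
    (coloringComplex G).faces = stableChains (⊥ : SimpleGraph (Fin d)) \ stableChains G := by
  ext F
  rw [mem_faces_coloringComplex]
  simp only [stableChains, Finset.mem_sdiff, Finset.mem_filter, Finset.mem_univ, true_and,
    SimpleGraph.bot_adj]
  push Not
  constructor
  · rintro ⟨h1, h2, h3⟩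
    exact ⟨⟨h1, h2, fun _ _ h => h.elim⟩, fun _ _ => h3⟩
  · rintro ⟨⟨h1, h2, -⟩, h3⟩
    exact ⟨h1, h2, h3 h1 h2⟩

theorem reducedEulerChar_coloringComplex (hd : 0 < d) :
    (coloringComplex G).reducedEulerChar =
      (-1) ^ d * (1 - (numAcyclicOrientations G : ℤ)) := by
  have hsub : stableChains G ⊆ stableChains (⊥ : SimpleGraph (Fin d)) := by
    intro F hF
    simp only [stableChains, Finset.mem_filter, Finset.mem_univ, true_and] at hF ⊢
    exact ⟨hF.1, hF.2.1, fun _ _ h => h.elim⟩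
  rw [FinComplex.reducedEulerChar, faces_coloringComplex_eq_sdiff,
    Finset.sum_sdiff_eq_sub hsub, sum_stableChains _ hd, sum_stableChains _ hd,
    numAcyclicOrientations_bot]
  push_cast
  ring

/-- For `k = r` every binomial coefficient in the `h`-vector formula is `1`, leaving the alternating
sum of face numbers. -/
theorem FinComplex.hVec_rank {α : Type*} (K : FinComplex α) :
    K.hVec K.rank = (-1) ^ (K.rank + 1) * K.reducedEulerChar := by
  have hmaps : ∀ s ∈ K.faces, s.card ∈ Finset.range (K.rank + 1) := fun s hs =>
    Finset.mem_range.2 (Nat.lt_succ_of_le (Finset.le_sup (f := Finset.card) hs))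
  rw [FinComplex.reducedEulerChar, ← Finset.sum_fiberwise_of_maps_to hmaps, Finset.mul_sum,
    FinComplex.hVec]
  refine Finset.sum_congr rfl fun i hi => ?_
  have hi' : i ≤ K.rank := Nat.le_of_lt_succ (Finset.mem_range.1 hi)
  rw [Finset.sum_congr rfl fun s hs => by rw [(Finset.mem_filter.1 hs).2], Finset.sum_const,
    Nat.choose_self, FinComplex.fVec, nsmul_eq_mul]
  obtain ⟨m, hm⟩ := Nat.exists_eq_add_of_le hi'
  have h1 : (-1 : ℤ) ^ (i + i) = 1 := Even.neg_one_pow ⟨i, rfl⟩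
  rw [hm, Nat.add_sub_cancel_left, Nat.cast_one, mul_one, mul_left_comm, ← pow_add,
    show i + m + 1 + (i + 1) = m + (i + i) + 2 by omega, pow_add, pow_add, h1]
  ring

theorem FinComplex.eulerChar_eq {α : Type*} (K : FinComplex α) (h : ∅ ∈ K.faces) :
    K.eulerChar = K.reducedEulerChar + 1 := by
  rw [FinComplex.eulerChar, FinComplex.reducedEulerChar,
    ← Finset.sum_filter_add_sum_filter_not K.faces (fun s => s.Nonempty)]
  have : K.faces.filter (fun s => ¬ s.Nonempty) = {∅} := by
    ext s
    simp only [Finset.mem_filter, Finset.not_nonempty_iff_eq_empty, Finset.mem_singleton]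
    exact ⟨fun hs => hs.2, fun hs => ⟨hs ▸ h, hs⟩⟩
  rw [this, Finset.sum_singleton]
  simp only [Finset.card_empty, zero_add, pow_one, neg_add_cancel_right]
  refine Finset.sum_congr rfl fun s hs => ?_
  obtain ⟨n, hn⟩ := Nat.exists_eq_add_of_le' (Finset.card_pos.2 (Finset.mem_filter.1 hs).2)
  rw [hn, Nat.add_sub_cancel]
  ring

/-- Some edge `u v` is not separated, so each member contains both ends or neither. Identifying them
gives a chain of nonempty proper subsets of a set of size `d - 1`; erasing `v` realizes this, and
the sizes are distinct numbers from `1` to `d - 2`. -/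
theorem card_add_two_le {F : Finset (Finset (Fin d))}
    (hF : F ∈ (coloringComplex G).faces) : F.card + 2 ≤ d := by
  obtain ⟨h1, h2, u, v, huv, he⟩ := mem_faces_coloringComplex.1 hF
  have hiff : ∀ S ∈ F, (u ∈ S ↔ v ∈ S) := by
    intro S hS
    by_contra hc
    rcases (by tauto : (u ∈ S ∧ v ∉ S) ∨ (v ∈ S ∧ u ∉ S)) with h | h
    · exact absurd ((depth_lt_iff h2).2 ⟨S, hS, h⟩) he.not_lt
    · exact absurd ((depth_lt_iff h2).2 ⟨S, hS, h⟩) he.symm.not_lt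
  have hd : 2 ≤ d := by
    have := Finset.card_le_univ {u, v}
    rwa [Finset.card_pair huv.ne, Fintype.card_fin] at this
  have hinj : Set.InjOn (fun S : Finset (Fin d) => (S.erase v).card) (F : Set (Finset (Fin d))) := by
    have main : ∀ S ∈ F, ∀ T ∈ F, S ⊆ T → (S.erase v).card = (T.erase v).card → S = T := by
      intro S hS T hT hST hc
      have he := Finset.eq_of_subset_of_card_le (Finset.erase_subset_erase v hST) hc.ge
      refine hST.antisymm fun w hw => ?_
      by_cases hwv : w = v
      · subst hwv
        have hu : u ∈ T.erase w := Finset.mem_erase.2 ⟨huv.ne, (hiff T hT).2 hw⟩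
        rw [← he] at hu
        exact (hiff S hS).1 (Finset.mem_of_mem_erase hu)
      · have : w ∈ T.erase v := Finset.mem_erase.2 ⟨hwv, hw⟩
        rw [← he] at this
        exact Finset.mem_of_mem_erase this
    intro S hS T hT hc
    rcases h2.total hS hT with h | h
    · exact main S hS T hT h hc
    · exact (main T hT S hS h hc.symm).symm
  have hmaps : ∀ S ∈ F, (S.erase v).card ∈ Finset.Icc 1 (d - 2) := by
    intro S hS
    obtain ⟨⟨w, hw⟩, hne⟩ := h1 S hS
    rw [Finset.mem_Icc]
    constructor
    · refine Finset.card_pos.2 ?_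
      by_cases hwv : w = v
      · subst hwv
        exact ⟨u, Finset.mem_erase.2 ⟨huv.ne, (hiff S hS).2 hw⟩⟩
      · exact ⟨w, Finset.mem_erase.2 ⟨hwv, hw⟩⟩
    · have hlt : S.card < d := by
        simpa using Finset.card_lt_univ_of_notMem
          (Classical.choose_spec (not_forall.1 (mt Finset.eq_univ_iff_forall.2 hne)))
      by_cases hv : v ∈ S
      · rw [Finset.card_erase_of_mem hv]
        omega
      · have hu : u ∉ S := fun h => hv ((hiff S hS).1 h)
        have hsub : S ⊆ Finset.univ \ {u, v} := by
          intro w hw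
          simp only [Finset.mem_sdiff, Finset.mem_univ, true_and, Finset.mem_insert,
            Finset.mem_singleton]
          rintro (rfl | rfl)
          · exact hu hw
          · exact hv hw
        have := Finset.card_le_card hsub
        rw [Finset.card_sdiff_of_subset (Finset.subset_univ _), Finset.card_pair huv.ne,
          Finset.card_univ, Fintype.card_fin] at this
        rwa [Finset.erase_eq_of_notMem hv]
  have := Finset.card_le_card_of_injOn _ hmaps hinj
  rw [Nat.card_Icc] at this
  omega

theorem card_initialLetters (π : Equiv.Perm (Fin d)) (k : Fin d) :
    (initialLetters π k).card = k := by
  rw [initialLetters, Finset.card_map, ← Fin.card_Iio k]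
  congr 1
  ext i
  simp only [Finset.mem_filter, Finset.mem_univ, true_and, Finset.mem_Iio]

theorem initialLetters_mono (π : Equiv.Perm (Fin d)) : Monotone (initialLetters π) := by
  intro k l hkl v hv
  obtain ⟨i, rfl⟩ := π.surjective v
  rw [mem_initialLetters] at hv ⊢
  exact hv.trans_le hkl

theorem exists_perm_first_two {i j u v : Fin d} (hij : i ≠ j) (huv : u ≠ v) :
    ∃ π : Equiv.Perm (Fin d), π i = u ∧ π j = v := by
  set τ := Equiv.swap i u
  have h : i ≠ τ.symm v := by
    intro h
    apply huv
    rw [Equiv.eq_symm_apply] at h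
    rw [← h, Equiv.swap_apply_left]
  refine ⟨(Equiv.swap j (τ.symm v)).trans τ, ?_, ?_⟩
  · rw [Equiv.trans_apply, Equiv.swap_apply_of_ne_of_ne hij h, Equiv.swap_apply_left]
  · simp

variable {G}

/-- For a permutation starting with the ends of an edge, the initial sets of sizes `2, …, d - 1`
never separate that edge. -/
theorem exists_face_card_add_two (hG : G ≠ ⊥) :
    ∃ F ∈ (coloringComplex G).faces, F.card + 2 = d := by
  obtain ⟨u, v, huv⟩ := SimpleGraph.ne_bot_iff_exists_adj.1 hG
  have hd : 2 ≤ d := by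
    have := Finset.card_le_univ {u, v}
    rwa [Finset.card_pair huv.ne, Fintype.card_fin] at this
  obtain ⟨π, hu, hv⟩ := exists_perm_first_two (i := ⟨0, by omega⟩) (j := ⟨1, by omega⟩)
    (by simp) huv.ne
  refine ⟨(Finset.univ.filter fun k : Fin d => 2 ≤ (k : ℕ)).image (initialLetters π),
    mem_faces_coloringComplex.2 ⟨?_, ?_, u, v, huv, ?_⟩, ?_⟩
  · intro S hS
    obtain ⟨k, hk, rfl⟩ := Finset.mem_image.1 hS
    have hk := (Finset.mem_filter.1 hk).2
    constructor
    · rw [← Finset.card_pos, card_initialLetters]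
      omega
    · intro h
      have := card_initialLetters π k
      rw [h, Finset.card_univ, Fintype.card_fin] at this
      omega
  · rintro S hS T hT -
    obtain ⟨k, -, rfl⟩ := Finset.mem_image.1 (Finset.mem_coe.1 hS)
    obtain ⟨l, -, rfl⟩ := Finset.mem_image.1 (Finset.mem_coe.1 hT)
    exact (le_total k l).imp (initialLetters_mono π ·) (initialLetters_mono π ·)
  · unfold depth
    congr 1
    ext S
    simp only [Finset.mem_filter]
    refine and_congr_right fun hS => not_congr ?_
    obtain ⟨k, hk, rfl⟩ := Finset.mem_image.1 hS
    have hk := (Finset.mem_filter.1 hk).2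
    rw [← hu, ← hv, mem_initialLetters, mem_initialLetters, Fin.lt_def, Fin.lt_def]
    simp only
    omega
  · rw [Finset.card_image_of_injective _ fun k l h => Fin.ext (by
      rw [← card_initialLetters π k, h, card_initialLetters])]
    have : ((Finset.univ.filter fun k : Fin d => 2 ≤ (k : ℕ)).map Fin.valEmbedding) =
        Finset.Ico 2 d := by
      ext n
      simp only [Finset.mem_map, Finset.mem_filter, Finset.mem_univ, true_and,
        Fin.valEmbedding_apply, Finset.mem_Ico]
      exact ⟨by rintro ⟨k, hk, rfl⟩; exact ⟨hk, k.2⟩, fun h => ⟨⟨n, h.2⟩, h.1, rfl⟩⟩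
    rw [← Finset.card_map Fin.valEmbedding, this, Nat.card_Ico]
    omega

theorem rank_coloringComplex (hG : G ≠ ⊥) : (coloringComplex G).rank + 2 = d := by
  obtain ⟨F, hF, hcard⟩ := exists_face_card_add_two hG
  have h1 : F.card ≤ (coloringComplex G).rank := Finset.le_sup (f := Finset.card) hF
  have h2 : (coloringComplex G).rank ≤ d - 2 := Finset.sup_le fun F' hF' => by
    have := card_add_two_le G hF'
    omega
  omega

end EulerCharacteristic

end ColoringComplex

theorem mainTheorem7 (d : ℕ) (G : SimpleGraph (Fin d)) :
    -- the reduced Euler characteristic with the sign `(-1) ^ (d - 3)` removed, plus one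
    ((-1 : ℤ) ^ (d + 1) * (ColoringComplex.coloringComplex G).reducedEulerChar + 1
        = (ColoringComplex.numAcyclicOrientations G : ℤ)) ∧
    -- the top entry of the `h`-vector, plus one
    ((ColoringComplex.coloringComplex G).hVec (ColoringComplex.coloringComplex G).rank + 1
        = (ColoringComplex.numAcyclicOrientations G : ℤ)) ∧
    -- the dimension and the unreduced Euler characteristic
    (G ≠ ⊥ →
      (ColoringComplex.coloringComplex G).rank + 2 = d ∧
      (Odd d → (ColoringComplex.coloringComplex G).eulerChar
        = (ColoringComplex.numAcyclicOrientations G : ℤ)) ∧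
      (Even d → (ColoringComplex.coloringComplex G).eulerChar
        = 2 - (ColoringComplex.numAcyclicOrientations G : ℤ))) := by
  -- Without edges there are no faces and `d` may be `0`; an edge forces `d ≥ 2` and makes the empty
  -- set a face.
  rcases eq_or_ne G ⊥ with rfl | hG
  · simp [ColoringComplex.FinComplex.hVec_rank, ColoringComplex.FinComplex.reducedEulerChar,
      ColoringComplex.faces_coloringComplex_bot, ColoringComplex.numAcyclicOrientations_bot]
  have hr := ColoringComplex.rank_coloringComplex hG
  have hχ := ColoringComplex.reducedEulerChar_coloringComplex G (by omega)
  have hsq : (-1 : ℤ) ^ d * (-1) ^ d = 1 := by rw [← mul_pow]; simp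
  have h1 : (-1 : ℤ) ^ (d + 1) * (ColoringComplex.coloringComplex G).reducedEulerChar + 1
      = (ColoringComplex.numAcyclicOrientations G : ℤ) := by
    rw [hχ, pow_succ]
    linear_combination ((ColoringComplex.numAcyclicOrientations G : ℤ) - 1) * hsq
  obtain ⟨F, hF, -⟩ := ColoringComplex.exists_face_card_add_two hG
  have he := ColoringComplex.FinComplex.eulerChar_eq _
    ((ColoringComplex.coloringComplex G).down_closed F hF ∅ (Finset.empty_subset F))
  refine ⟨h1, ?_, fun _ => ⟨hr, fun hd => ?_, fun hd => ?_⟩⟩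
  · rw [ColoringComplex.FinComplex.hVec_rank, ← h1]
    -- The fifth `d` is the exponent, the others being implicit arguments; `d + 1` and the rank plus
    -- one have equal parity.
    nth_rewrite 5 [← hr]
    ring
  · rw [he, hχ, hd.neg_one_pow]
    ring
  · rw [he, hχ, hd.neg_one_pow]
    ring
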